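/- Let $P_0$ be a probability distribution on $\mathbb{R}$ that is absolutely continuous with respect to Lebesgue measure (the initial predictive distribution given the data $\mathcal{D}_n$ and a fixed feature value $x$; distributions on $\mathbb R$ are identified with their CDFs). Let $n \in \mathbb{N}$, $\rho \in (-1,1)$, and let $(\alpha_{n+k})_{k\ge 1}$ be a deterministic sequence of learning rates in $[0,1]$, for instance $\alpha_i = (2-i^{-1})(i+1)^{-1}$, or $\alpha_{n+k} = C(n+k+1)^{-\beta}$ with $C>0$ and $\beta\in(0,1]$ such that these numbers are at most $1$. Let $\Phi$ be the standard normal CDF and $$H_\rho(u,v) = \Phi\left(\frac{\Phi^{-1}(u)-\rho\,\Phi^{-1}(v)}{\sqrt{1-\rho^2}}\right),\qquad H_\rho(0,v)=0,\quad H_\rho(1,v)=1.$$ Let the real random variables $y_{n+1}, y_{n+2},\dots$ be sampled iteratively: $y_{n+1}\sim P_0$ and, for $k\ge 1$, conditionally on $y_{n+1},\dots,y_{n+k}$, $y_{n+k+1}\sim P_k$, where $$P_k(y) = (1-\alpha_{n+k})P_{k-1}(y)+\alpha_{n+k}H_\rho\big(P_{k-1}(y),P_{k-1}(y_{n+k})\big).$$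 Then there exists a random probability distribution $P_{\infty,x}$ on $\mathbb{R}$ such that for every $y\in\mathbb{R}$, almost surely, $$\lim_{N\to\infty}P_N(y) = P_{\infty,x}(y) = F_{\infty,x}(y), \qquad\text{where } F_{\infty,x}(y) = \lim_{N\to\infty}\frac1N\sum_{i=1}^N \mathbf{1}(y_{n+i}\le y),$$ and both limits exist. Moreover, almost surely, these limits exist and the equalities hold simultaneously for all continuity points $y$ of $P_{\infty,x}$ (so that $P_N$ and the empirical distributions of the forward samples converge weakly to $P_{\infty,x}$). -/

import Mathlib

open MeasureTheory ProbabilityTheory Filter Topology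

noncomputable section

/-- The standard normal cumulative distribution function `Φ`. -/
def stdNormalCDF (z : ℝ) : ℝ := cdf (gaussianReal 0 1) z

/-- The standard normal quantile function `Φ⁻¹`. It is the inverse of `Φ` on `(0, 1)`; outside
`(0, 1)`, where `Φ⁻¹` is not a real number, the value is immaterial. -/
def stdNormalQuantile (u : ℝ) : ℝ := sInf {z : ℝ | u ≤ stdNormalCDF z}

/-- The conditional Gaussian copula
`H_ρ(u, v) = Φ((Φ⁻¹(u) - ρ Φ⁻¹(v)) / √(1 - ρ²))`,
where at the end points `u = 0` and `u = 1` it is read with `Φ⁻¹(0) = -∞`, `Φ⁻¹(1) = ∞`,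
`Φ(-∞) = 0` and `Φ(∞) = 1`. (It is only evaluated at `u ∈ [0, 1]`, and almost surely only at
`v ∈ (0, 1)`.) -/
def copulaH (ρ u v : ℝ) : ℝ :=
  if u ≤ 0 then 0
  else if 1 ≤ u then 1
  else stdNormalCDF ((stdNormalQuantile u - ρ * stdNormalQuantile v) / √(1 - ρ ^ 2))

/-- The predictive distribution function `P_k` after `k` copula updates, started in `P_0`, where
`y j` is the `(j + 1)`-st forward sample `y_{n+j+1}`:
`P_k(t) = (1 - α_{n+k}) P_{k-1}(t) + α_{n+k} H_ρ(P_{k-1}(t), P_{k-1}(y_{n+k}))`. -/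
def predictiveCDF (P₀ : Measure ℝ) (ρ : ℝ) (α : ℕ → ℝ) (n : ℕ) (y : ℕ → ℝ) : ℕ → ℝ → ℝ
  | 0 => fun t => cdf P₀ t
  | k + 1 => fun t =>
      (1 - α (n + (k + 1))) * predictiveCDF P₀ ρ α n y k t
        + α (n + (k + 1)) *
          copulaH ρ (predictiveCDF P₀ ρ α n y k t) (predictiveCDF P₀ ρ α n y k (y k))

/-- The empirical distribution function `(1/N) ∑_{i=1}^N 1(y_{n+i} ≤ t)` of the first `N` forward
samples, where `y j` is `y_{n+j+1}`. -/
def empiricalCDF (y : ℕ → ℝ) (N : ℕ) (t : ℝ) : ℝ :=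
  (1 / (N : ℝ)) * ∑ i ∈ Finset.range N, (Set.Iic t).indicator (fun _ => (1 : ℝ)) (y i)

/-- `Y 0, Y 1, …` (that is, `y_{n+1}, y_{n+2}, …`) is generated by the iterative sampling scheme
`y_{n+1} ∼ P_0, y_{n+2} ∼ P_1, y_{n+3} ∼ P_2, …`: the conditional distribution of `y_{n+k+1}`
given `y_{n+1}, …, y_{n+k}` has distribution function `P_k`. -/
structure IsForwardSampling {Ω : Type*} [MeasurableSpace Ω] (μ : Measure Ω)
    (P₀ : Measure ℝ) (ρ : ℝ) (α : ℕ → ℝ) (n : ℕ) (Y : ℕ → Ω → ℝ) : Prop where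
  measurable : ∀ k, Measurable (Y k)
  condCDF_eq : ∀ (k : ℕ) (t : ℝ),
    μ[{ω | Y k ω ≤ t}.indicator (fun _ => (1 : ℝ)) |
        ⨆ j : Fin k, MeasurableSpace.comap (Y j) inferInstance]
      =ᵐ[μ] fun ω => predictiveCDF P₀ ρ α n (fun j => Y j ω) k t

end

/-!
At each fixed point `t` the predictive values `P_k(t)` form a bounded martingale. Every copula
update is continuous and monotone in its first argument, so `P_k` is a continuous distribution
function along every sample path. Hence, conditionally on the first `k` samples, the normal score
`Φ⁻¹(P_k(Y_k))` of the next sample is standard normal (`map_stdNormalQuantile_cdf`). The average of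
`H_ρ(u, ·)` over such a score is the distribution function of `ρ Z + √(1 - ρ²) W` at `Φ⁻¹(u)`, with
`Z`, `W` independent standard normals, which is `u` (`integral_copulaH_cdf`). Passing from the
prescribed conditional distribution function to an integral of `H_ρ` uses a regular conditional
distribution; this gives `IsForwardSampling.martingale_predictiveCDF`.

Martingale convergence gives an almost sure limit `L(t)` at each `t`, with mean `P_0(t)`. The random
function `L` is almost surely monotone on countable sets. By monotone convergence of means, the
right-continuity of `P_0` and its limits at `±∞` carry over to `L` almost surely along sequences,
which suffices to realise `L` by a Markov kernel (`exists_kernel_tendsto_cdf`).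

The differences `1(Y_k ≤ t) - P_k(t)` are bounded martingale differences, so their averages tend to
zero (`ae_tendsto_average_zero_of_condExp_eq_zero`). The empirical distribution function thus has the
same limit as the Cesàro averages of `P_k(t)`, which is `L(t)`. Convergence at the rationals,
together with monotonicity, gives simultaneous convergence at all continuity points.
-/

/-! ### The standard normal distribution and quantile functions -/

lemma stdNormalCDF_eq_real (z : ℝ) :
    stdNormalCDF z = (gaussianReal 0 1).real (Set.Iic z) := cdf_eq_real _ z

lemma strictMono_stdNormalCDF : StrictMono stdNormalCDF := by
  intro a b hab
  have hpos : 0 < (gaussianReal 0 1).real (Set.Ioc a b) := by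
    refine ENNReal.toReal_pos (fun h0 => ?_) (measure_ne_top _ _)
    have := gaussianReal_absolutelyContinuous' 0 one_ne_zero h0
    simp only [Real.volume_Ioc, ENNReal.ofReal_eq_zero] at this
    linarith
  rw [stdNormalCDF_eq_real, stdNormalCDF_eq_real, ← Set.Iic_union_Ioc_eq_Iic hab.le,
    measureReal_union (Set.Iic_disjoint_Ioc le_rfl) measurableSet_Ioc]
  linarith

/-- A measure without atoms has a continuous distribution function. -/
lemma continuous_cdf_of_forall_singleton (m : Measure ℝ) [IsProbabilityMeasure m]
    (hm : ∀ x, m {x} = 0) : Continuous (cdf m) := by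
  refine continuous_iff_continuousAt.2 fun x => ?_
  rw [(monotone_cdf m).continuousAt_iff_leftLim_eq_rightLim, StieltjesFunction.rightLim_eq]
  have h := hm x
  rw [← measure_cdf m, StieltjesFunction.measure_singleton, ENNReal.ofReal_eq_zero] at h
  exact le_antisymm ((monotone_cdf m).leftLim_le le_rfl) (by linarith)

lemma continuous_stdNormalCDF : Continuous stdNormalCDF := by
  refine continuous_cdf_of_forall_singleton _ fun x => ?_
  exact gaussianReal_absolutelyContinuous 0 one_ne_zero (by simp)

lemma stdNormalCDF_mem_Ioo (z : ℝ) : stdNormalCDF z ∈ Set.Ioo 0 1 :=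
  ⟨(cdf_nonneg _ (z - 1)).trans_lt (strictMono_stdNormalCDF (by linarith)),
    (strictMono_stdNormalCDF (by linarith : z < z + 1)).trans_le (cdf_le_one _ (z + 1))⟩

lemma exists_stdNormalCDF_eq {u : ℝ} (hu : u ∈ Set.Ioo 0 1) : ∃ z, stdNormalCDF z = u :=
  mem_range_of_exists_le_of_exists_ge continuous_stdNormalCDF
    (((tendsto_cdf_atBot (gaussianReal 0 1)).eventually (ge_mem_nhds hu.1)).exists)
    (((tendsto_cdf_atTop (gaussianReal 0 1)).eventually (le_mem_nhds hu.2)).exists)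

@[simp] lemma stdNormalQuantile_stdNormalCDF (z : ℝ) :
    stdNormalQuantile (stdNormalCDF z) = z := by
  simp only [stdNormalQuantile, strictMono_stdNormalCDF.le_iff_le]
  exact csInf_Ici

lemma stdNormalCDF_stdNormalQuantile {u : ℝ} (hu : u ∈ Set.Ioo 0 1) :
    stdNormalCDF (stdNormalQuantile u) = u := by
  obtain ⟨z, rfl⟩ := exists_stdNormalCDF_eq hu
  simp

lemma stdNormalQuantile_le_iff {u z : ℝ} (hu : u ∈ Set.Ioo 0 1) :
    stdNormalQuantile u ≤ z ↔ u ≤ stdNormalCDF z := by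
  rw [← strictMono_stdNormalCDF.le_iff_le, stdNormalCDF_stdNormalQuantile hu]

lemma monotoneOn_stdNormalQuantile : MonotoneOn stdNormalQuantile (Set.Ioo 0 1) := by
  intro u hu v hv huv
  rwa [stdNormalQuantile_le_iff hu, stdNormalCDF_stdNormalQuantile hv]

lemma stdNormalQuantile_of_notMem {u : ℝ} (hu : u ∉ Set.Ioo 0 1) : stdNormalQuantile u = 0 := by
  rcases le_or_gt u 0 with h | h
  · have : {z : ℝ | u ≤ stdNormalCDF z} = Set.univ :=
      Set.eq_univ_of_forall fun z => h.trans (stdNormalCDF_mem_Ioo z).1.le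
    rw [stdNormalQuantile, this, Real.sInf_univ]
  · have h1 : 1 ≤ u := not_lt.1 fun h1 => hu ⟨h, h1⟩
    have : {z : ℝ | u ≤ stdNormalCDF z} = ∅ :=
      Set.eq_empty_of_forall_notMem fun z hz =>
        (h1.trans hz).not_gt (stdNormalCDF_mem_Ioo z).2
    rw [stdNormalQuantile, this, Real.sInf_empty]

lemma measurable_stdNormalQuantile : Measurable stdNormalQuantile := by
  refine measurable_of_Iic fun z => ?_
  have : stdNormalQuantile ⁻¹' Set.Iic z =
      (Set.Ioo 0 1 ∩ Set.Iic (stdNormalCDF z)) ∪ ((Set.Ioo 0 1)ᶜ ∩ {_u : ℝ | 0 ≤ z}) := by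
    ext u
    by_cases hu : u ∈ Set.Ioo (0 : ℝ) 1
    · simp only [Set.mem_preimage, Set.mem_Iic, stdNormalQuantile_le_iff hu, Set.mem_union,
        Set.mem_inter_iff, hu, Set.mem_compl_iff, true_and, not_true, false_and, or_false]
    · simp [stdNormalQuantile_of_notMem hu, hu, -Set.mem_Ioo]
  rw [this]
  exact (measurableSet_Ioo.inter measurableSet_Iic).union
    (measurableSet_Ioo.compl.inter (MeasurableSet.const _))

/-! ### The conditional Gaussian copula as a function -/

lemma copulaH_of_mem {u : ℝ} (hu : u ∈ Set.Ioo 0 1) (ρ v : ℝ) :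
    copulaH ρ u v =
      stdNormalCDF ((stdNormalQuantile u - ρ * stdNormalQuantile v) / √(1 - ρ ^ 2)) := by
  rw [copulaH, if_neg (not_le.2 hu.1), if_neg (not_le.2 hu.2)]

lemma copulaH_of_nonpos {u : ℝ} (hu : u ≤ 0) (ρ v : ℝ) : copulaH ρ u v = 0 := by
  rw [copulaH, if_pos hu]

lemma copulaH_of_one_le {u : ℝ} (hu : 1 ≤ u) (ρ v : ℝ) : copulaH ρ u v = 1 := by
  rw [copulaH, if_neg (by linarith), if_pos hu]

lemma copulaH_mem_Icc (ρ u v : ℝ) : copulaH ρ u v ∈ Set.Icc 0 1 := by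
  unfold copulaH
  split_ifs
  · simp
  · simp
  · exact Set.Ioo_subset_Icc_self (stdNormalCDF_mem_Ioo _)

lemma monotone_copulaH (ρ v : ℝ) : Monotone fun u => copulaH ρ u v := by
  intro u u' huu
  dsimp only
  rcases le_or_gt u 0 with h0 | h0
  · rw [copulaH_of_nonpos h0]; exact (copulaH_mem_Icc _ _ _).1
  rcases le_or_gt 1 u' with h1 | h1
  · rw [copulaH_of_one_le h1]; exact (copulaH_mem_Icc _ _ _).2
  have hu : u ∈ Set.Ioo (0 : ℝ) 1 := ⟨h0, huu.trans_lt h1⟩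
  have hu' : u' ∈ Set.Ioo (0 : ℝ) 1 := ⟨h0.trans_le huu, h1⟩
  rw [copulaH_of_mem hu, copulaH_of_mem hu']
  refine strictMono_stdNormalCDF.monotone ?_
  gcongr
  exact monotoneOn_stdNormalQuantile hu hu' huu

/-- For every second argument, even one outside `(0, 1)`, the conditional copula is continuous in
its first argument: it is monotone and takes every value in `[0, 1]`. -/
lemma continuous_copulaH {ρ : ℝ} (hρ : ρ ∈ Set.Ioo (-1) 1) (v : ℝ) :
    Continuous fun u => copulaH ρ u v := by
  have hs : 0 < √(1 - ρ ^ 2) := Real.sqrt_pos.2 (by nlinarith [hρ.1, hρ.2])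
  let f : ℝ → Set.Icc (0 : ℝ) 1 := fun u => ⟨copulaH ρ u v, copulaH_mem_Icc ρ u v⟩
  have hf : Monotone f := fun a b hab => monotone_copulaH ρ v hab
  have hsurj : Function.Surjective f := by
    rintro ⟨p, hp0, hp1⟩
    rcases hp0.eq_or_lt with rfl | hp0
    · exact ⟨0, Subtype.ext (copulaH_of_nonpos le_rfl ρ v)⟩
    rcases hp1.eq_or_lt with rfl | hp1
    · exact ⟨1, Subtype.ext (copulaH_of_one_le le_rfl ρ v)⟩
    obtain ⟨w, rfl⟩ := exists_stdNormalCDF_eq ⟨hp0, hp1⟩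
    refine ⟨stdNormalCDF (√(1 - ρ ^ 2) * w + ρ * stdNormalQuantile v), Subtype.ext ?_⟩
    simp only [f]
    rw [copulaH_of_mem (stdNormalCDF_mem_Ioo _), stdNormalQuantile_stdNormalCDF]
    congr 1
    field_simp
    ring
  exact continuous_subtype_val.comp (hf.continuous_of_surjective hsurj)

lemma measurable_copulaH (ρ : ℝ) : Measurable fun p : ℝ × ℝ => copulaH ρ p.1 p.2 := by
  unfold copulaH
  refine Measurable.ite (measurableSet_le measurable_fst measurable_const) measurable_const
    (Measurable.ite (measurableSet_le measurable_const measurable_fst) measurable_const ?_)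
  exact continuous_stdNormalCDF.measurable.comp
    (((measurable_stdNormalQuantile.comp measurable_fst).sub
      ((measurable_stdNormalQuantile.comp measurable_snd).const_mul ρ)).div_const _)

/-! ### The copula averaged over its second argument -/

/-- Averaging `Φ((a - ρ z) / √(1 - ρ²))` over a standard normal `z` gives `Φ(a)`, because
`ρ Z + √(1 - ρ²) W` is standard normal when `Z` and `W` are independent standard normals. -/
lemma integral_stdNormalCDF_gaussianReal {ρ : ℝ} (hρ : ρ ∈ Set.Ioo (-1) 1) (a : ℝ) :
    ∫ z, stdNormalCDF ((a - ρ * z) / √(1 - ρ ^ 2)) ∂gaussianReal 0 1 = stdNormalCDF a := by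
  have hpos : 0 < 1 - ρ ^ 2 := by nlinarith [hρ.1, hρ.2]
  set s := √(1 - ρ ^ 2) with hs_def
  have hs : 0 < s := Real.sqrt_pos.2 hpos
  have hs2 : s ^ 2 = 1 - ρ ^ 2 := Real.sq_sqrt hpos.le
  set γ := gaussianReal 0 1 with hγ
  have hmap : (γ.prod γ).map (fun p : ℝ × ℝ => ρ * p.1 + s * p.2) = γ := by
    have h1 : (γ.map (ρ * ·)).conv (γ.map (s * ·)) = γ := by
      rw [hγ, gaussianReal_map_const_mul, gaussianReal_map_const_mul,
        gaussianReal_conv_gaussianReal]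
      congr 1
      · simp
      · ext
        push_cast
        simp [hs2]
    rw [Measure.conv, Measure.map_prod_map _ _ (by fun_prop) (by fun_prop),
      Measure.map_map (by fun_prop) (by fun_prop)] at h1
    exact h1
  have hmeas : MeasurableSet {p : ℝ × ℝ | ρ * p.1 + s * p.2 ≤ a} :=
    measurableSet_le (by fun_prop) measurable_const
  have hlin : γ (Set.Iic a) = ∫⁻ z, γ (Set.Iic ((a - ρ * z) / s)) ∂γ := by
    conv_lhs => rw [← hmap]
    rw [Measure.map_apply (by fun_prop) measurableSet_Iic]
    change (γ.prod γ) {p : ℝ × ℝ | ρ * p.1 + s * p.2 ≤ a} = _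
    rw [Measure.prod_apply hmeas]
    refine lintegral_congr fun z => ?_
    congr 1
    ext w
    simp only [Set.mem_preimage, Set.mem_ofPred_eq, Set.mem_Iic, le_div_iff₀ hs]
    constructor <;> intro h <;> linarith
  rw [stdNormalCDF_eq_real, measureReal_def, hlin, ← integral_toReal]
  · exact integral_congr_ae (.of_forall fun z => stdNormalCDF_eq_real _)
  · have : (fun z => γ (Set.Iic ((a - ρ * z) / s))) =
        fun z => ENNReal.ofReal (stdNormalCDF ((a - ρ * z) / s)) :=
      funext fun z => (ofReal_cdf γ _).symm
    rw [this]
    exact (continuous_stdNormalCDF.measurable.comp (by fun_prop)).ennreal_ofReal.aemeasurable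
  · exact .of_forall fun z => measure_lt_top _ _

/-- The probability integral transform: a continuous distribution function `F` satisfies
`P(F(Y) ≤ p) = p` when `Y` has distribution function `F`. -/
lemma measureReal_cdf_le {m : Measure ℝ} [IsProbabilityMeasure m] (hm : Continuous (cdf m))
    {p : ℝ} (hp : p ∈ Set.Ioo 0 1) : m.real {y | cdf m y ≤ p} = p := by
  have hclosed : IsClosed {y | cdf m y ≤ p} := isClosed_le hm continuous_const
  have hne : {y | cdf m y ≤ p}.Nonempty :=
    ((tendsto_cdf_atBot m).eventually (ge_mem_nhds hp.1)).exists
  obtain ⟨c, hc⟩ := ((tendsto_cdf_atTop m).eventually (lt_mem_nhds hp.2)).exists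
  have hbdd : BddAbove {y | cdf m y ≤ p} :=
    ⟨c, fun y hy => (not_lt.1 fun hcy => (hc.trans_le (monotone_cdf m hcy.le)).not_ge hy)⟩
  set b := sSup {y | cdf m y ≤ p}
  have hb : cdf m b ≤ p := hclosed.csSup_mem hne hbdd
  have hset : {y | cdf m y ≤ p} = Set.Iic b :=
    Set.Subset.antisymm (fun y hy => le_csSup hbdd hy)
      fun y hy => (monotone_cdf m hy).trans hb
  have hb' : p ≤ cdf m b := by
    refine le_of_tendsto_of_tendsto tendsto_const_nhds
      ((hm.tendsto b).mono_left (nhdsWithin_le_nhds (s := Set.Ioi b))) ?_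
    filter_upwards [self_mem_nhdsWithin] with y hy
    exact (not_le.1 fun h => (not_le.2 hy) (le_csSup hbdd h)).le
  rw [hset, ← cdf_eq_real]
  exact le_antisymm hb hb'

/-- The normal scores `Φ⁻¹(F(Y))` of a variable with continuous distribution function `F` are
standard normal. -/
lemma map_stdNormalQuantile_cdf {m : Measure ℝ} [IsProbabilityMeasure m]
    (hm : Continuous (cdf m)) :
    m.map (fun y => stdNormalQuantile (cdf m y)) = gaussianReal 0 1 := by
  have hmeas : Measurable fun y => stdNormalQuantile (cdf m y) :=
    measurable_stdNormalQuantile.comp hm.measurable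
  have hP : IsProbabilityMeasure (m.map fun y => stdNormalQuantile (cdf m y)) :=
    Measure.isProbabilityMeasure_map hmeas.aemeasurable
  have hpit := fun p (hp : p ∈ Set.Ioo (0 : ℝ) 1) => measureReal_cdf_le hm hp
  -- The junk values of the quantile at `0` and `1` are almost surely not met.
  have h0 : ∀ᵐ y ∂m, 0 < cdf m y := by
    rw [ae_iff, ← measureReal_eq_zero_iff]
    refine le_antisymm (le_of_forall_pos_le_add fun ε hε => ?_) measureReal_nonneg
    have h := hpit (min ε (1 / 2)) ⟨by positivity, by
      exact (min_le_right _ _).trans_lt (by norm_num)⟩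
    rw [zero_add]
    refine le_trans (measureReal_mono fun y hy => ?_) (h.le.trans (min_le_left _ _))
    exact (not_lt.1 hy).trans (by positivity)
  have h1 : ∀ᵐ y ∂m, cdf m y < 1 := by
    rw [ae_iff, ← measureReal_eq_zero_iff]
    refine le_antisymm (le_of_forall_pos_le_add fun ε hε => ?_) measureReal_nonneg
    have hδ : 0 < min ε (1 / 2) := by positivity
    have hδ' : min ε (1 / 2) < 1 := (min_le_right _ _).trans_lt (by norm_num)
    have h := hpit (1 - min ε (1 / 2)) ⟨by linarith, by linarith⟩
    have hms : MeasurableSet {y | cdf m y ≤ 1 - min ε (1 / 2)} :=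
      measurableSet_le hm.measurable measurable_const
    have hcompl := probReal_compl_eq_one_sub (μ := m) hms
    rw [h] at hcompl
    have hmono : m.real {y | ¬ cdf m y < 1} ≤ m.real {y | cdf m y ≤ 1 - min ε (1 / 2)}ᶜ :=
      measureReal_mono fun y hy hy' => hy (lt_of_le_of_lt hy' (by linarith))
    have := min_le_left ε (1 / 2)
    linarith
  refine Measure.eq_of_cdf _ _ (StieltjesFunction.ext fun z => ?_)
  rw [cdf_eq_real, map_measureReal_apply hmeas measurableSet_Iic]
  change _ = stdNormalCDF z
  rw [← hpit _ (stdNormalCDF_mem_Ioo z)]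
  refine measureReal_congr ?_
  filter_upwards [h0, h1] with y hy0 hy1
  exact propext (stdNormalQuantile_le_iff ⟨hy0, hy1⟩)

/-- The conditional copula averages to its first argument, `∫ H_ρ(u, v) dv = u`; here `v` is the
uniform variable `F(Y)` for `Y` with continuous distribution function `F`. -/
lemma integral_copulaH_cdf {ρ : ℝ} (hρ : ρ ∈ Set.Ioo (-1) 1) {m : Measure ℝ}
    [IsProbabilityMeasure m] (hm : Continuous (cdf m)) {u : ℝ} (hu : u ∈ Set.Icc 0 1) :
    ∫ y, copulaH ρ u (cdf m y) ∂m = u := by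
  rcases hu.1.eq_or_lt with rfl | h0
  · simp [copulaH_of_nonpos]
  rcases hu.2.eq_or_lt with rfl | h1
  · simp [copulaH_of_one_le]
  simp only [copulaH_of_mem ⟨h0, h1⟩]
  have hmeas : Measurable fun y => stdNormalQuantile (cdf m y) :=
    measurable_stdNormalQuantile.comp hm.measurable
  have hcont : Continuous fun z =>
      stdNormalCDF ((stdNormalQuantile u - ρ * z) / √(1 - ρ ^ 2)) :=
    continuous_stdNormalCDF.comp (by fun_prop)
  rw [← integral_map (f := fun z => stdNormalCDF ((stdNormalQuantile u - ρ * z) / √(1 - ρ ^ 2)))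
    hmeas.aemeasurable hcont.aestronglyMeasurable, map_stdNormalQuantile_cdf hm,
    integral_stdNormalCDF_gaussianReal hρ, stdNormalCDF_stdNormalQuantile ⟨h0, h1⟩]

/-! ### Predictive distribution functions along a sample path -/

lemma predictiveCDF_succ (P₀ : Measure ℝ) (ρ : ℝ) (α : ℕ → ℝ) (n : ℕ) (y : ℕ → ℝ) (k : ℕ)
    (t : ℝ) :
    predictiveCDF P₀ ρ α n y (k + 1) t =
      (1 - α (n + (k + 1))) * predictiveCDF P₀ ρ α n y k t
        + α (n + (k + 1)) *
          copulaH ρ (predictiveCDF P₀ ρ α n y k t) (predictiveCDF P₀ ρ α n y k (y k)) := rfl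

section Predictive

variable {P₀ : Measure ℝ} {ρ : ℝ} {α : ℕ → ℝ} {n : ℕ}

lemma predictiveCDF_mem_Icc (hα : ∀ k, 1 ≤ k → α (n + k) ∈ Set.Icc (0 : ℝ) 1)
    (y : ℕ → ℝ) (k : ℕ) (t : ℝ) : predictiveCDF P₀ ρ α n y k t ∈ Set.Icc 0 1 := by
  induction k with
  | zero => exact ⟨cdf_nonneg _ _, cdf_le_one _ _⟩
  | succ k ih =>
    have ha := hα (k + 1) (by omega)
    rw [predictiveCDF_succ]
    exact convex_Icc (0 : ℝ) 1 ih (copulaH_mem_Icc _ _ _) (by linarith [ha.2]) ha.1 (by ring)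

lemma monotone_predictiveCDF (hα : ∀ k, 1 ≤ k → α (n + k) ∈ Set.Icc (0 : ℝ) 1)
    (y : ℕ → ℝ) (k : ℕ) : Monotone (predictiveCDF P₀ ρ α n y k) := by
  induction k with
  | zero => exact monotone_cdf P₀
  | succ k ih =>
    intro s t hst
    have ha := hα (k + 1) (by omega)
    rw [predictiveCDF_succ, predictiveCDF_succ]
    exact add_le_add (mul_le_mul_of_nonneg_left (ih hst) (by linarith [ha.2]))
      (mul_le_mul_of_nonneg_left (monotone_copulaH _ _ (ih hst)) ha.1)

lemma continuous_predictiveCDF (hρ : ρ ∈ Set.Ioo (-1) 1) (hP₀ : Continuous (cdf P₀))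
    (y : ℕ → ℝ) (k : ℕ) : Continuous (predictiveCDF P₀ ρ α n y k) := by
  induction k with
  | zero => exact hP₀
  | succ k ih =>
    exact (ih.const_mul _).add (((continuous_copulaH hρ _).comp ih).const_mul _)

lemma predictiveCDF_congr {y z : ℕ → ℝ} {k : ℕ} (h : ∀ j < k, y j = z j) (t : ℝ) :
    predictiveCDF P₀ ρ α n y k t = predictiveCDF P₀ ρ α n z k t := by
  induction k generalizing t with
  | zero => rfl
  | succ k ih =>
    have ih' := ih fun j hj => h j (by omega)
    rw [predictiveCDF_succ, predictiveCDF_succ, ih', ih', h k (by omega)]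

/-- `P_k` is a jointly measurable function of the evaluation point and the first `k` samples; only
these samples have to be measurable. -/
lemma measurable_predictiveCDF {β : Type*} [MeasurableSpace β] {y : ℕ → β → ℝ} {k : ℕ}
    (hy : ∀ j < k, Measurable (y j)) {t : β → ℝ} (ht : Measurable t) :
    Measurable fun b => predictiveCDF P₀ ρ α n (fun j => y j b) k (t b) := by
  induction k generalizing t with
  | zero => exact (monotone_cdf P₀).measurable.comp ht
  | succ k ih =>
    have ih' := fun {s : β → ℝ} (hs : Measurable s) => ih (fun j hj => hy j (by omega)) hs
    exact ((ih' ht).const_mul _).add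
      (((measurable_copulaH ρ).comp ((ih' ht).prodMk (ih' (hy k (by omega))))).const_mul _)

end Predictive

/-! ### The martingale property -/

/-- The filtration generated by the samples: at time `k` the first `k` samples
`Y 0, …, Y (k - 1)` are known. -/
def sampleFiltration {Ω : Type*} [mΩ : MeasurableSpace Ω] (Y : ℕ → Ω → ℝ)
    (hY : ∀ k, Measurable (Y k)) : Filtration ℕ mΩ where
  seq k := ⨆ j : Fin k, MeasurableSpace.comap (Y j) inferInstance
  mono' _ l hkl := iSup_le fun j =>
    le_iSup (fun j : Fin l => MeasurableSpace.comap (Y j) inferInstance) (Fin.castLE hkl j)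
  le' _ := iSup_le fun j => (hY j).comap_le

lemma measurable_sampleFiltration {Ω : Type*} [MeasurableSpace Ω] {Y : ℕ → Ω → ℝ}
    (hY : ∀ k, Measurable (Y k)) {j k : ℕ} (hjk : j < k) :
    Measurable[sampleFiltration Y hY k] (Y j) :=
  Measurable.of_comap_le
    (le_iSup (fun j : Fin k => MeasurableSpace.comap (Y j) inferInstance) ⟨j, hjk⟩)

lemma sampleFiltration_eq_comap {Ω : Type*} [MeasurableSpace Ω] {Y : ℕ → Ω → ℝ}
    (hY : ∀ k, Measurable (Y k)) (k : ℕ) :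
    sampleFiltration Y hY k =
      MeasurableSpace.comap (fun ω (j : Fin k) => Y j ω) MeasurableSpace.pi := by
  simp only [MeasurableSpace.pi, MeasurableSpace.comap_iSup, MeasurableSpace.comap_comp]
  rfl

namespace IsForwardSampling

variable {Ω : Type*} [MeasurableSpace Ω] {μ : Measure Ω}
  {P₀ : Measure ℝ} {ρ : ℝ} {α : ℕ → ℝ} {n : ℕ} {Y : ℕ → Ω → ℝ}

lemma measurable_predictiveCDF (hY : IsForwardSampling μ P₀ ρ α n Y) (k : ℕ) (t : ℝ) :
    Measurable[sampleFiltration Y hY.measurable k]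
      fun ω => predictiveCDF P₀ ρ α n (fun j => Y j ω) k t :=
  @_root_.measurable_predictiveCDF _ _ _ _ Ω (sampleFiltration Y hY.measurable k) Y k
    (fun _ hj => measurable_sampleFiltration hY.measurable hj) _ (@measurable_const _ _ _ _ t)

variable [IsProbabilityMeasure μ]

lemma integrable_predictiveCDF (hα : ∀ k, 1 ≤ k → α (n + k) ∈ Set.Icc (0 : ℝ) 1)
    (hY : IsForwardSampling μ P₀ ρ α n Y) (k : ℕ) (t : ℝ) :
    Integrable (fun ω => predictiveCDF P₀ ρ α n (fun j => Y j ω) k t) μ := by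
  refine Integrable.of_bound ((hY.measurable_predictiveCDF k t).mono
    ((sampleFiltration Y hY.measurable).le k) le_rfl).aestronglyMeasurable 1 (.of_forall fun ω => ?_)
  have h := predictiveCDF_mem_Icc (P₀ := P₀) (ρ := ρ) hα (fun j => Y j ω) k t
  rw [Real.norm_of_nonneg h.1]
  exact h.2

/-- Almost surely, the regular conditional distribution of the next sample has distribution
function `P_k` at all points simultaneously. -/
lemma ae_cdf_condDistrib_eq (hρ : ρ ∈ Set.Ioo (-1) 1) (hP₀ : Continuous (cdf P₀))
    (hY : IsForwardSampling μ P₀ ρ α n Y) (k : ℕ) :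
    ∀ᵐ ω ∂μ, ∀ t : ℝ, cdf (condDistrib (Y k) (fun ω (j : Fin k) => Y j ω) μ fun j => Y j ω) t =
      predictiveCDF P₀ ρ α n (fun j => Y j ω) k t := by
  have hX : Measurable fun ω (j : Fin k) => Y j ω := measurable_pi_lambda _ fun j => hY.measurable j
  have hrat : ∀ᵐ ω ∂μ, ∀ q : ℚ,
      cdf (condDistrib (Y k) (fun ω (j : Fin k) => Y j ω) μ fun j => Y j ω) (q : ℝ) =
        predictiveCDF P₀ ρ α n (fun j => Y j ω) k q := by
    refine ae_all_iff.2 fun q => ?_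
    have h1 := condDistrib_ae_eq_condExp (μ := μ) hX (hY.measurable k)
      (measurableSet_Iic (a := (q : ℝ)))
    have h2 := hY.condCDF_eq k q
    change μ[_ | sampleFiltration Y hY.measurable k] =ᵐ[μ] _ at h2
    rw [sampleFiltration_eq_comap] at h2
    filter_upwards [h1, h2] with ω h1 h2
    rw [cdf_eq_real, h1, ← h2]
    rfl
  filter_upwards [hrat] with ω hω t
  -- Both sides are right-continuous, so the rational points to the right of `t` decide.
  obtain ⟨q, -, hqt, hq⟩ := Real.exists_seq_rat_strictAnti_tendsto t
  have hl := ((cdf (condDistrib (Y k) (fun ω (j : Fin k) => Y j ω) μ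
    fun j => Y j ω)).right_continuous t).tendsto.comp
      (tendsto_nhdsWithin_iff.2 ⟨hq, .of_forall fun i => (hqt i).le⟩)
  have hr := ((continuous_predictiveCDF (P₀ := P₀) (α := α) (n := n) hρ hP₀
    (fun j => Y j ω) k).tendsto t).comp hq
  exact tendsto_nhds_unique hl (hr.congr fun i => (hω (q i)).symm)

/-- Averaged over the next sample, the copula update leaves the predictive distribution function
unchanged. -/
lemma condExp_copulaH (hρ : ρ ∈ Set.Ioo (-1) 1) (hP₀ : Continuous (cdf P₀))
    (hY : IsForwardSampling μ P₀ ρ α n Y) (k : ℕ) (t : ℝ) :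
    μ[fun ω => copulaH ρ (predictiveCDF P₀ ρ α n (fun j => Y j ω) k t)
        (predictiveCDF P₀ ρ α n (fun j => Y j ω) k (Y k ω)) |
      sampleFiltration Y hY.measurable k]
      =ᵐ[μ] fun ω => predictiveCDF P₀ ρ α n (fun j => Y j ω) k t := by
  have hX : Measurable fun ω (j : Fin k) => Y j ω := measurable_pi_lambda _ fun j => hY.measurable j
  -- Extending the first `k` samples by zeros does not change `P_k`.
  let e : (Fin k → ℝ) → ℕ → ℝ := fun x j => if h : j < k then x ⟨j, h⟩ else 0
  have he : ∀ (ω : Ω) (s : ℝ), predictiveCDF P₀ ρ α n (e fun j => Y j ω) k s =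
      predictiveCDF P₀ ρ α n (fun j => Y j ω) k s := fun ω s =>
    predictiveCDF_congr (fun j hj => by simp [e, hj]) s
  have hP : ∀ {s : (Fin k → ℝ) × ℝ → ℝ}, Measurable s →
      Measurable fun p : (Fin k → ℝ) × ℝ => predictiveCDF P₀ ρ α n (e p.1) k (s p) := by
    intro s hs
    refine _root_.measurable_predictiveCDF (y := fun j p => e p.1 j) (fun j hj => ?_) hs
    simp only [e, hj, dif_pos]
    fun_prop
  have hf : Measurable fun p : (Fin k → ℝ) × ℝ =>
      copulaH ρ (predictiveCDF P₀ ρ α n (e p.1) k t) (predictiveCDF P₀ ρ α n (e p.1) k p.2) :=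
    (measurable_copulaH ρ).comp ((hP measurable_const).prodMk (hP measurable_snd))
  have h := condExp_prod_ae_eq_integral_condDistrib (μ := μ) hX (hY.measurable k).aemeasurable
    hf.stronglyMeasurable (Integrable.of_bound
      (hf.comp (hX.prodMk (hY.measurable k))).aestronglyMeasurable 1 (.of_forall fun ω => by
        have h := copulaH_mem_Icc ρ (predictiveCDF P₀ ρ α n (e fun j => Y j ω) k t)
          (predictiveCDF P₀ ρ α n (e fun j => Y j ω) k (Y k ω))
        exact (Real.norm_of_nonneg h.1).trans_le h.2))
  simp only [he] at h
  rw [sampleFiltration_eq_comap]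
  filter_upwards [h, hY.ae_cdf_condDistrib_eq hρ hP₀ k] with ω hω hcdf
  rw [hω]
  have hcont : Continuous
      (cdf (condDistrib (Y k) (fun ω (j : Fin k) => Y j ω) μ fun j => Y j ω)) := by
    simp only [funext hcdf]
    exact continuous_predictiveCDF hρ hP₀ _ k
  simp only [← hcdf]
  exact integral_copulaH_cdf hρ hcont ⟨cdf_nonneg _ _, cdf_le_one _ _⟩

/-- The predictive distribution functions form a martingale at each point. -/
theorem martingale_predictiveCDF (hρ : ρ ∈ Set.Ioo (-1) 1) (hP₀ : Continuous (cdf P₀))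
    (hα : ∀ k, 1 ≤ k → α (n + k) ∈ Set.Icc (0 : ℝ) 1)
    (hY : IsForwardSampling μ P₀ ρ α n Y) (t : ℝ) :
    Martingale (fun k ω => predictiveCDF P₀ ρ α n (fun j => Y j ω) k t)
      (sampleFiltration Y hY.measurable) μ := by
  refine martingale_nat (fun k => (hY.measurable_predictiveCDF k t).stronglyMeasurable)
    (hY.integrable_predictiveCDF hα · t) fun k => ?_
  have hm := (sampleFiltration Y hY.measurable).le k
  have hPk : Measurable fun ω => predictiveCDF P₀ ρ α n (fun j => Y j ω) k (Y k ω) :=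
    _root_.measurable_predictiveCDF (fun j _ => hY.measurable j) (hY.measurable k)
  have hint : Integrable (fun ω => copulaH ρ (predictiveCDF P₀ ρ α n (fun j => Y j ω) k t)
      (predictiveCDF P₀ ρ α n (fun j => Y j ω) k (Y k ω))) μ :=
    Integrable.of_bound ((measurable_copulaH ρ).comp
      (((hY.measurable_predictiveCDF k t).mono hm le_rfl).prodMk hPk)).aestronglyMeasurable 1
      (.of_forall fun ω => by
        rw [Real.norm_of_nonneg (copulaH_mem_Icc _ _ _).1]
        exact (copulaH_mem_Icc _ _ _).2)
  have hPint := hY.integrable_predictiveCDF hα k t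
  have hadd := condExp_add (hPint.const_mul (1 - α (n + (k + 1))))
    (hint.const_mul (α (n + (k + 1)))) (sampleFiltration Y hY.measurable k)
  have h1 := condExp_smul (μ := μ) (1 - α (n + (k + 1)))
    (fun ω => predictiveCDF P₀ ρ α n (fun j => Y j ω) k t) (sampleFiltration Y hY.measurable k)
  have h2 := condExp_smul (μ := μ) (α (n + (k + 1)))
    (fun ω => copulaH ρ (predictiveCDF P₀ ρ α n (fun j => Y j ω) k t)
      (predictiveCDF P₀ ρ α n (fun j => Y j ω) k (Y k ω))) (sampleFiltration Y hY.measurable k)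
  have h3 := condExp_of_stronglyMeasurable hm
    (hY.measurable_predictiveCDF k t).stronglyMeasurable hPint
  filter_upwards [hadd, h1, h2, hY.condExp_copulaH hρ hP₀ k t] with ω hadd h1 h2 h4
  refine Eq.symm (hadd.trans ?_)
  rw [Pi.add_apply]
  refine (congrArg₂ (· + ·) h1 h2).trans ?_
  simp only [Pi.smul_apply, smul_eq_mul, h4, h3]
  ring

end IsForwardSampling

/-! ### Limits of random distribution functions -/

section RandomCDF

variable {Ω : Type*} [MeasurableSpace Ω] {μ : Measure Ω} [IsProbabilityMeasure μ]
  {M : ℕ → Ω → ℝ → ℝ} {P₀ : Measure ℝ}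

/-- If random distribution functions `M N` with mean `F` (a fixed distribution function) converge
almost surely at each point, then the limit is given at each point, almost surely, by the
distribution functions of a Markov kernel. Right-continuity of the limit and its values at `±∞`
come from those of `F`: by monotonicity a discrepancy would show in the mean. -/
theorem exists_kernel_tendsto_cdf (hmeas : ∀ N t, Measurable fun ω => M N ω t)
    (hmono : ∀ N ω, Monotone (M N ω)) (hM : ∀ N ω t, M N ω t ∈ Set.Icc (0 : ℝ) 1)
    (hmean : ∀ N t, ∫ ω, M N ω t ∂μ = cdf P₀ t)
    (hconv : ∀ t, ∀ᵐ ω ∂μ, ∃ l, Tendsto (fun N => M N ω t) atTop (𝓝 l)) :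
    ∃ κ : Kernel Ω ℝ, IsMarkovKernel κ ∧
      ∀ t, ∀ᵐ ω ∂μ, Tendsto (fun N => M N ω t) atTop (𝓝 (cdf (κ ω) t)) := by
  let L : ℝ → Ω → ℝ := fun t ω => limsup (fun N => M N ω t) atTop
  have hLmeas : ∀ t, Measurable (L t) := fun t => Measurable.limsup fun N => hmeas N t
  have hL : ∀ t, ∀ᵐ ω ∂μ, Tendsto (fun N => M N ω t) atTop (𝓝 (L t ω)) := fun t => by
    filter_upwards [hconv t] with ω ⟨l, hl⟩
    simpa only [L, hl.limsup_eq] using hl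
  have hL01 : ∀ t, ∀ᵐ ω ∂μ, L t ω ∈ Set.Icc (0 : ℝ) 1 := fun t => by
    filter_upwards [hL t] with ω hω
    exact isClosed_Icc.mem_of_tendsto hω (.of_forall fun N => hM N ω t)
  have hLint : ∀ t, Integrable (L t) μ := fun t =>
    Integrable.of_bound (hLmeas t).aestronglyMeasurable 1 (by
      filter_upwards [hL01 t] with ω hω
      rw [Real.norm_of_nonneg hω.1]
      exact hω.2)
  have hLmean : ∀ t, ∫ ω, L t ω ∂μ = cdf P₀ t := fun t => by
    have h := tendsto_integral_of_dominated_convergence (μ := μ) (fun _ => (1 : ℝ))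
      (fun N => (hmeas N t).aestronglyMeasurable) (integrable_const _)
      (fun N => .of_forall fun ω => by
        rw [Real.norm_of_nonneg (hM N ω t).1]
        exact (hM N ω t).2) (hL t)
    simp only [hmean] at h
    exact (tendsto_nhds_unique h tendsto_const_nhds)
  have hLmono : ∀ s t, s ≤ t → ∀ᵐ ω ∂μ, L s ω ≤ L t ω := fun s t hst => by
    filter_upwards [hL s, hL t] with ω hs ht
    exact le_of_tendsto_of_tendsto' hs ht fun N => hmono N ω hst
  -- Right-continuity along a fixed sequence, and the values at `±∞`.
  have hright : ∀ (t : ℝ) (q : ℕ → ℝ), Antitone q → (∀ i, t ≤ q i) → Tendsto q atTop (𝓝 t) →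
      ∀ᵐ ω ∂μ, Tendsto (fun i => L (q i) ω) atTop (𝓝 (L t ω)) := by
    intro t q hq htq hqt
    refine tendsto_of_integral_tendsto_of_antitone (fun i => hLint _) (hLint t) ?_ ?_ ?_
    · simp only [hLmean]
      exact ((cdf P₀).right_continuous t).tendsto.comp
        (tendsto_nhdsWithin_iff.2 ⟨hqt, .of_forall htq⟩)
    · filter_upwards [ae_all_iff.2 fun p : ℕ × ℕ => hLmono _ _ (hq (le_max_left p.1 p.2))]
        with ω hω i j hij
      simpa [max_eq_right hij] using hω (i, j)
    · exact ae_all_iff.2 fun i => hLmono _ _ (htq i)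
  have htop : ∀ᵐ ω ∂μ, Tendsto (fun i : ℕ => L i ω) atTop (𝓝 1) := by
    refine tendsto_of_integral_tendsto_of_monotone (F := fun _ => (1 : ℝ)) (fun i => hLint _)
      (integrable_const _) ?_ ?_ ?_
    · simp only [hLmean, integral_const, probReal_univ, one_smul]
      exact (tendsto_cdf_atTop P₀).comp tendsto_natCast_atTop_atTop
    · filter_upwards [ae_all_iff.2 fun p : ℕ × ℕ =>
        hLmono _ _ (Nat.mono_cast (α := ℝ) (le_max_left p.1 p.2))] with ω hω i j hij
      simpa only [max_eq_right hij] using hω (i, j)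
    · filter_upwards [ae_all_iff.2 fun i : ℕ => hL01 (i : ℝ)] with ω hω i
      exact (hω i).2
  have hbot : ∀ᵐ ω ∂μ, Tendsto (fun i : ℕ => L (-i) ω) atTop (𝓝 0) := by
    refine tendsto_of_integral_tendsto_of_antitone (F := fun _ => (0 : ℝ)) (fun i => hLint _)
      (integrable_const _) ?_ ?_ ?_
    · simp only [hLmean, integral_const, smul_zero]
      exact (tendsto_cdf_atBot P₀).comp
        (tendsto_neg_atTop_atBot.comp tendsto_natCast_atTop_atTop)
    · filter_upwards [ae_all_iff.2 fun p : ℕ × ℕ =>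
        hLmono _ _ (neg_le_neg (Nat.mono_cast (α := ℝ) (le_max_left p.1 p.2)))] with ω hω i j hij
      simpa only [max_eq_right hij] using hω (i, j)
    · filter_upwards [ae_all_iff.2 fun i : ℕ => hL01 (-i : ℝ)] with ω hω i
      exact (hω i).1
  let f : Ω → ℚ → ℝ := fun ω q => L q ω
  have hf : Measurable f := measurable_pi_lambda _ fun q => hLmeas q
  have hε : Tendsto (fun i : ℕ => 1 / ((i : ℝ) + 1)) atTop (𝓝 0) :=
    tendsto_one_div_add_atTop_nhds_zero_nat
  have hpoint : ∀ᵐ ω ∂μ, IsRatStieltjesPoint f ω := by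
    have h1 : ∀ᵐ ω ∂μ, ∀ p q : ℚ, p ≤ q → f ω p ≤ f ω q :=
      ae_all_iff.2 fun p => ae_all_iff.2 fun q => by
        by_cases hpq : p ≤ q
        · filter_upwards [hLmono p q (by exact_mod_cast hpq)] with ω hω _
          exact hω
        · exact .of_forall fun ω h => absurd h hpq
    have h2 : ∀ᵐ ω ∂μ, ∀ q : ℚ,
        Tendsto (fun i : ℕ => L ((q : ℝ) + 1 / ((i : ℝ) + 1)) ω) atTop (𝓝 (L q ω)) :=
      ae_all_iff.2 fun q => hright q _
        (fun i j hij => add_le_add le_rfl (Nat.one_div_le_one_div hij))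
        (fun i => le_add_of_nonneg_right (by positivity)) (by simpa using hε.const_add (q : ℝ))
    filter_upwards [h1, h2, htop, hbot, ae_all_iff.2 fun q : ℚ => hL01 q]
      with ω h1 h2 htop hbot h01
    have hm : Monotone (f ω) := fun p q hpq => h1 p q hpq
    refine ⟨hm, ?_, ?_, fun t => ?_⟩
    · refine tendsto_order.2 ⟨fun a ha => ?_, fun a ha => ?_⟩
      · obtain ⟨i, hi⟩ := (htop.eventually (lt_mem_nhds ha)).exists
        filter_upwards [eventually_ge_atTop (i : ℚ)] with q hq
        refine lt_of_lt_of_le ?_ (hm hq)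
        simpa [f] using hi
      · exact .of_forall fun q => (h01 q).2.trans_lt ha
    · refine tendsto_order.2 ⟨fun a ha => ?_, fun a ha => ?_⟩
      · exact .of_forall fun q => ha.trans_le (h01 q).1
      · obtain ⟨i, hi⟩ := (hbot.eventually (gt_mem_nhds ha)).exists
        filter_upwards [eventually_le_atBot (-i : ℚ)] with q hq
        refine lt_of_le_of_lt (hm hq) ?_
        simpa [f] using hi
    · have hne : Nonempty (Set.Ioi t) := ⟨⟨t + 1, by simp⟩⟩
      refine le_antisymm (ge_of_tendsto' (h2 t) fun i => ?_) (le_ciInf fun r => hm r.2.le)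
      have hb : BddBelow (Set.range fun r : Set.Ioi t => f ω r) :=
        ⟨f ω t, by rintro _ ⟨r, rfl⟩; exact hm r.2.le⟩
      have hi : t + 1 / ((i : ℚ) + 1) ∈ Set.Ioi t := by
        rw [Set.mem_Ioi, lt_add_iff_pos_right]
        positivity
      refine (ciInf_le hb ⟨_, hi⟩).trans_eq ?_
      simp [f]
  let κ : Kernel Ω ℝ := ⟨fun ω => (stieltjesOfMeasurableRat f hf ω).measure,
    measurable_measure_stieltjesOfMeasurableRat hf⟩
  have hκ : ∀ ω, cdf (κ ω) = stieltjesOfMeasurableRat f hf ω := fun ω =>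
    cdf_measure_stieltjesFunction _ (tendsto_stieltjesOfMeasurableRat_atBot hf ω)
      (tendsto_stieltjesOfMeasurableRat_atTop hf ω)
  refine ⟨κ, ⟨fun ω => instIsProbabilityMeasure_stieltjesOfMeasurableRat hf ω⟩, fun t => ?_⟩
  obtain ⟨q, hq, htq, hqt⟩ := Real.exists_seq_rat_strictAnti_tendsto t
  have hr := hright t (fun i => q i) (fun i j hij => Rat.cast_le.2 (hq.antitone hij))
    (fun i => (htq i).le) hqt
  filter_upwards [hpoint, hL t, hr] with ω hω hLω hrω
  have h : Tendsto (fun i => cdf (κ ω) (q i)) atTop (𝓝 (cdf (κ ω) t)) :=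
    ((cdf (κ ω)).right_continuous t).tendsto.comp
      (tendsto_nhdsWithin_iff.2 ⟨hqt, .of_forall fun i => (htq i).le⟩)
  have heq : ∀ i, cdf (κ ω) (q i) = L (q i) ω := fun i => by
    rw [hκ, stieltjesOfMeasurableRat_eq, toRatCDF_of_isRatStieltjesPoint hω]
  simp only [heq] at h
  rwa [tendsto_nhds_unique h hrω]

end RandomCDF

/-- Monotone functions that converge at the rational points to a monotone function converge at
each of its continuity points. -/
lemma tendsto_of_tendsto_rat_of_continuousAt {G : ℕ → ℝ → ℝ} {g : ℝ → ℝ}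
    (hG : ∀ N, Monotone (G N)) (h : ∀ q : ℚ, Tendsto (fun N => G N q) atTop (𝓝 (g q)))
    {t : ℝ} (ht : ContinuousAt g t) : Tendsto (fun N => G N t) atTop (𝓝 (g t)) := by
  refine tendsto_order.2 ⟨fun a ha => ?_, fun a ha => ?_⟩
  · obtain ⟨δ, hδ, hs⟩ := Metric.eventually_nhds_iff.1 (ht.eventually (lt_mem_nhds ha))
    obtain ⟨q, hq1, hq2⟩ := exists_rat_btwn (sub_lt_self t hδ)
    have hgq : a < g q := hs (by rw [Real.dist_eq, abs_lt]; constructor <;> linarith)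
    filter_upwards [(h q).eventually (lt_mem_nhds hgq)] with N hN
    exact hN.trans_le (hG N hq2.le)
  · obtain ⟨δ, hδ, hs⟩ := Metric.eventually_nhds_iff.1 (ht.eventually (gt_mem_nhds ha))
    obtain ⟨q, hq1, hq2⟩ := exists_rat_btwn (lt_add_of_pos_right t hδ)
    have hgq : g q < a := hs (by rw [Real.dist_eq, abs_lt]; constructor <;> linarith)
    filter_upwards [(h q).eventually (gt_mem_nhds hgq)] with N hN
    exact (hG N hq1.le).trans_lt hN

/-! ### A strong law for bounded martingale differences -/

section StrongLaw

lemma abs_sum_range_le {Ω : Type*} {D : ℕ → Ω → ℝ} (hbdd : ∀ i ω, |D i ω| ≤ 1) (N : ℕ) (ω : Ω) :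
    |∑ i ∈ Finset.range N, D i ω| ≤ N := by
  refine (Finset.abs_sum_le_sum_abs _ _).trans ((Finset.sum_le_sum fun i _ => hbdd i ω).trans ?_)
  simp

variable {Ω : Type*} [mΩ : MeasurableSpace Ω] {μ : Measure Ω} [IsProbabilityMeasure μ]
  {ℱ : Filtration ℕ mΩ} {D : ℕ → Ω → ℝ}

/-- Bounded martingale differences are orthogonal, so the second moment of their partial sums
grows at most linearly. -/
lemma integral_sq_sum_range_le (hD : ∀ i, Measurable[ℱ (i + 1)] (D i))
    (hbdd : ∀ i ω, |D i ω| ≤ 1) (hcond : ∀ i, μ[D i | ℱ i] =ᵐ[μ] 0) (N : ℕ) :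
    ∫ ω, (∑ i ∈ Finset.range N, D i ω) ^ 2 ∂μ ≤ N := by
  induction N with
  | zero => simp
  | succ N ih =>
    have hDm : ∀ i, Measurable (D i) := fun i => (hD i).mono (ℱ.le _) le_rfl
    have hSm : Measurable[ℱ N] fun ω => ∑ i ∈ Finset.range N, D i ω :=
      Finset.measurable_fun_sum _ fun i hi =>
        (hD i).mono (ℱ.mono (Nat.succ_le_of_lt (Finset.mem_range.1 hi))) le_rfl
    have hSm' := hSm.mono (ℱ.le N) le_rfl
    have hDint : Integrable (D N) μ :=
      Integrable.of_bound (hDm N).aestronglyMeasurable 1 (.of_forall (hbdd N))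
    have hprod : Integrable (fun ω => (∑ i ∈ Finset.range N, D i ω) * D N ω) μ := by
      refine hDint.bdd_mul (c := (N : ℝ)) hSm'.aestronglyMeasurable (.of_forall fun ω => ?_)
      exact abs_sum_range_le hbdd N ω
    have hsq : ∀ K : ℕ, Integrable (fun ω => (∑ i ∈ Finset.range K, D i ω) ^ 2) μ := fun K => by
      refine Integrable.of_bound (C := (K : ℝ) ^ 2)
        ((Finset.measurable_fun_sum _ fun i _ => hDm i).pow_const 2).aestronglyMeasurable
        (.of_forall fun ω => ?_)
      rw [norm_pow, Real.norm_eq_abs]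
      exact pow_le_pow_left₀ (abs_nonneg _) (abs_sum_range_le hbdd K ω) 2
    have hDsq : Integrable (fun ω => D N ω ^ 2) μ := by
      refine Integrable.of_bound (C := 1) ((hDm N).pow_const 2).aestronglyMeasurable
        (.of_forall fun ω => ?_)
      rw [norm_pow, Real.norm_eq_abs]
      exact pow_le_one₀ (abs_nonneg _) (hbdd N ω)
    have horth : ∫ ω, (∑ i ∈ Finset.range N, D i ω) * D N ω ∂μ = 0 := by
      rw [← integral_condExp (ℱ.le N)]
      refine integral_eq_zero_of_ae ?_
      have h := condExp_mul_of_stronglyMeasurable_left hSm.stronglyMeasurable hprod hDint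
      filter_upwards [h, hcond N] with ω h h0
      refine h.trans ?_
      rw [Pi.mul_apply, h0, Pi.zero_apply, mul_zero]
    have hle : ∫ ω, D N ω ^ 2 ∂μ ≤ 1 := by
      refine (integral_mono hDsq (integrable_const (1 : ℝ)) fun ω => ?_).trans (by simp)
      exact (sq_le_one_iff_abs_le_one _).2 (hbdd N ω)
    have hexp : ∀ ω, (∑ i ∈ Finset.range (N + 1), D i ω) ^ 2 =
        (∑ i ∈ Finset.range N, D i ω) ^ 2 + 2 * ((∑ i ∈ Finset.range N, D i ω) * D N ω)
          + D N ω ^ 2 := fun ω => by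
      rw [Finset.sum_range_succ]; ring
    simp only [hexp]
    have h1 := integral_add ((hsq N).add (hprod.const_mul 2)) hDsq
    have h2 := integral_add (hsq N) (hprod.const_mul 2)
    rw [integral_const_mul, horth] at h2
    refine (h1.trans (congrArg (· + _) h2)).trans_le ?_
    push_cast
    linarith

/-- Strong law of large numbers for bounded martingale differences. Along the squares `k ^ 2` the
second moments of the averages are summable; between consecutive squares the partial sums move by
at most `2 k`. -/
theorem ae_tendsto_average_zero_of_condExp_eq_zero (hD : ∀ i, Measurable[ℱ (i + 1)] (D i))
    (hbdd : ∀ i ω, |D i ω| ≤ 1) (hcond : ∀ i, μ[D i | ℱ i] =ᵐ[μ] 0) :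
    ∀ᵐ ω ∂μ, Tendsto (fun N : ℕ => 1 / (N : ℝ) * ∑ i ∈ Finset.range N, D i ω) atTop (𝓝 0) := by
  have hDm : ∀ i, Measurable (D i) := fun i => (hD i).mono (ℱ.le _) le_rfl
  let A : ℕ → Ω → ℝ := fun k ω => 1 / (k ^ 2 : ℝ) * ∑ i ∈ Finset.range (k ^ 2), D i ω
  have hAm : ∀ k, Measurable (A k) := fun k =>
    (Finset.measurable_fun_sum _ fun i _ => hDm i).const_mul _
  have hA : ∀ k, ∫⁻ ω, ENNReal.ofReal (A k ω ^ 2) ∂μ ≤ ENNReal.ofReal (1 / (k : ℝ) ^ 2) := by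
    intro k
    have hAint : Integrable (fun ω => A k ω ^ 2) μ := by
      refine Integrable.of_bound (C := 1) ((hAm k).pow_const 2).aestronglyMeasurable
        (.of_forall fun ω => ?_)
      rw [norm_pow, Real.norm_eq_abs]
      refine pow_le_one₀ (abs_nonneg _) ?_
      have h := abs_sum_range_le hbdd (k ^ 2) ω
      push_cast at h
      rw [abs_mul, abs_of_nonneg (by positivity), one_div_mul_eq_div]
      exact div_le_one_of_le₀ h (by positivity)
    rw [← ofReal_integral_eq_lintegral_ofReal hAint (.of_forall fun ω => sq_nonneg _)]
    refine ENNReal.ofReal_le_ofReal ?_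
    simp only [A, mul_pow]
    rw [integral_const_mul]
    have h := integral_sq_sum_range_le hD hbdd hcond (k ^ 2)
    refine (mul_le_mul_of_nonneg_left h (by positivity)).trans_eq ?_
    rcases eq_or_ne k 0 with rfl | hk
    · simp
    · push_cast
      field_simp
  have hsum : ∫⁻ ω, ∑' k, ENNReal.ofReal (A k ω ^ 2) ∂μ ≠ ⊤ := by
    rw [lintegral_tsum fun k => ((hAm k).pow_const 2).ennreal_ofReal.aemeasurable]
    refine ne_top_of_le_ne_top ?_ (ENNReal.tsum_le_tsum hA)
    exact (Real.summable_one_div_nat_pow.2 one_lt_two).tsum_ofReal_ne_top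
  have hfin := ae_lt_top' (Measurable.tsum fun k =>
    ((hAm k).pow_const 2).ennreal_ofReal).aemeasurable hsum
  filter_upwards [hfin] with ω hω
  have hA0 : Tendsto (fun k => |A k ω|) atTop (𝓝 0) := by
    have h := ENNReal.tendsto_atTop_zero_of_tsum_ne_top hω.ne
    have h' := (ENNReal.tendsto_toReal ENNReal.zero_ne_top).comp h
    have h'' := (Real.continuous_sqrt.tendsto _).comp h'
    simpa [Function.comp_def, ENNReal.toReal_ofReal (sq_nonneg _), Real.sqrt_sq_eq_abs] using h''
  have hsqrt : Tendsto Nat.sqrt atTop atTop :=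
    tendsto_atTop_atTop.2 fun b => ⟨b ^ 2, fun N hN => Nat.le_sqrt'.2 hN⟩
  have hinv : Tendsto (fun k : ℕ => 2 * (1 / (k : ℝ))) atTop (𝓝 0) := by
    simpa using (tendsto_one_div_atTop_nhds_zero_nat (𝕜 := ℝ)).const_mul 2
  have hlim : Tendsto (fun N : ℕ => |A N.sqrt ω| + 2 * (1 / (N.sqrt : ℝ))) atTop (𝓝 0) := by
    simpa [Function.comp_def] using (hA0.add hinv).comp hsqrt
  refine squeeze_zero_norm' ?_ hlim
  filter_upwards [eventually_ge_atTop 1] with N hN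
  set k := N.sqrt
  have hk : 0 < k := Nat.sqrt_pos.2 hN
  have hk' : (0 : ℝ) < k := by exact_mod_cast hk
  have hkN : k ^ 2 ≤ N := Nat.sqrt_le' N
  have hNk : N ≤ k ^ 2 + 2 * k := by
    have := Nat.sqrt_le_add N
    simp only [k, sq]
    omega
  have hkN' : (k : ℝ) ^ 2 ≤ N := by exact_mod_cast hkN
  have hgap : |∑ i ∈ Finset.Ico (k ^ 2) N, D i ω| ≤ 2 * k := by
    refine (Finset.abs_sum_le_sum_abs _ _).trans
      ((Finset.sum_le_sum fun i _ => hbdd i ω).trans ?_)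
    rw [Finset.sum_const, Nat.card_Ico, nsmul_one]
    exact_mod_cast (by omega : N - k ^ 2 ≤ 2 * k)
  rw [Real.norm_eq_abs, abs_mul, abs_of_nonneg (by positivity),
    ← Finset.sum_range_add_sum_Ico _ hkN]
  calc 1 / (N : ℝ) * |∑ i ∈ Finset.range (k ^ 2), D i ω + ∑ i ∈ Finset.Ico (k ^ 2) N, D i ω|
      ≤ 1 / (k : ℝ) ^ 2 * (|∑ i ∈ Finset.range (k ^ 2), D i ω| + 2 * k) := by
        gcongr
        exact (abs_add_le _ _).trans (add_le_add le_rfl hgap)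
    _ = |A k ω| + 2 * (1 / (k : ℝ)) := by
        simp only [A]
        rw [abs_mul, abs_of_nonneg (by positivity : (0 : ℝ) ≤ 1 / (k : ℝ) ^ 2)]
        field_simp

end StrongLaw

/-! ### Convergence of the predictive and empirical distribution functions -/

namespace IsForwardSampling

variable {Ω : Type*} [MeasurableSpace Ω] {μ : Measure Ω} [IsProbabilityMeasure μ]
  {P₀ : Measure ℝ} {ρ : ℝ} {α : ℕ → ℝ} {n : ℕ} {Y : ℕ → Ω → ℝ}

lemma integral_predictiveCDF (hρ : ρ ∈ Set.Ioo (-1) 1) (hP₀ : Continuous (cdf P₀))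
    (hα : ∀ k, 1 ≤ k → α (n + k) ∈ Set.Icc (0 : ℝ) 1)
    (hY : IsForwardSampling μ P₀ ρ α n Y) (k : ℕ) (t : ℝ) :
    ∫ ω, predictiveCDF P₀ ρ α n (fun j => Y j ω) k t ∂μ = cdf P₀ t := by
  have h := (hY.martingale_predictiveCDF hρ hP₀ hα t).setIntegral_eq k.zero_le
    (MeasurableSet.univ (m := sampleFiltration Y hY.measurable 0))
  simpa [predictiveCDF] using h.symm

lemma ae_exists_tendsto_predictiveCDF (hρ : ρ ∈ Set.Ioo (-1) 1) (hP₀ : Continuous (cdf P₀))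
    (hα : ∀ k, 1 ≤ k → α (n + k) ∈ Set.Icc (0 : ℝ) 1)
    (hY : IsForwardSampling μ P₀ ρ α n Y) (t : ℝ) :
    ∀ᵐ ω ∂μ, ∃ l,
      Tendsto (fun k => predictiveCDF P₀ ρ α n (fun j => Y j ω) k t) atTop (𝓝 l) := by
  refine (hY.martingale_predictiveCDF hρ hP₀ hα t).submartingale.exists_ae_tendsto_of_bdd
    (R := 1) fun k => ?_
  refine (eLpNorm_le_of_ae_bound (C := 1) (.of_forall fun ω => ?_)).trans (by simp)
  have h := predictiveCDF_mem_Icc (P₀ := P₀) (ρ := ρ) hα (fun j => Y j ω) k t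
  exact (Real.norm_of_nonneg h.1).trans_le h.2

/-- The empirical distribution function and the running average of the predictive distribution
functions are asymptotically equal, by the strong law for martingale differences. -/
lemma ae_tendsto_empiricalCDF_sub (hα : ∀ k, 1 ≤ k → α (n + k) ∈ Set.Icc (0 : ℝ) 1)
    (hY : IsForwardSampling μ P₀ ρ α n Y) (t : ℝ) :
    ∀ᵐ ω ∂μ, Tendsto (fun N : ℕ => empiricalCDF (fun j => Y j ω) N t -
      (N : ℝ)⁻¹ * ∑ i ∈ Finset.range N, predictiveCDF P₀ ρ α n (fun j => Y j ω) i t)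
      atTop (𝓝 0) := by
  let D : ℕ → Ω → ℝ := fun i => {ω | Y i ω ≤ t}.indicator (fun _ => (1 : ℝ)) -
    fun ω => predictiveCDF P₀ ρ α n (fun j => Y j ω) i t
  have hD : ∀ i, Measurable[sampleFiltration Y hY.measurable (i + 1)] (D i) := fun i =>
    (measurable_const.indicator
      (measurable_sampleFiltration hY.measurable i.lt_succ_self measurableSet_Iic)).sub
      ((hY.measurable_predictiveCDF i t).mono
        ((sampleFiltration Y hY.measurable).mono i.le_succ) le_rfl)
  have hbdd : ∀ i ω, |D i ω| ≤ 1 := fun i ω => by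
    have h := predictiveCDF_mem_Icc (P₀ := P₀) (ρ := ρ) hα (fun j => Y j ω) i t
    simp only [D, Pi.sub_apply, Set.indicator_apply, abs_le]
    split_ifs <;> constructor <;> linarith [h.1, h.2]
  have hcond : ∀ i, μ[D i | sampleFiltration Y hY.measurable i] =ᵐ[μ] 0 := fun i => by
    have hm := (sampleFiltration Y hY.measurable).le i
    have hPint := hY.integrable_predictiveCDF hα i t
    have hset : MeasurableSet {ω | Y i ω ≤ t} := hY.measurable i measurableSet_Iic
    have hsub := condExp_sub ((integrable_const (1 : ℝ)).indicator hset) hPint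
      (sampleFiltration Y hY.measurable i)
    have h1 : μ[_ | sampleFiltration Y hY.measurable i] =ᵐ[μ] _ := hY.condCDF_eq i t
    have h2 := condExp_of_stronglyMeasurable hm
      (hY.measurable_predictiveCDF i t).stronglyMeasurable hPint
    filter_upwards [hsub, h1] with ω hsub h1
    refine hsub.trans ?_
    rw [Pi.sub_apply, h1, h2, sub_self, Pi.zero_apply]
  filter_upwards [ae_tendsto_average_zero_of_condExp_eq_zero hD hbdd hcond] with ω hω
  refine hω.congr fun N => ?_
  simp only [D, empiricalCDF, Pi.sub_apply, Finset.sum_sub_distrib, mul_sub, one_div]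
  rfl

end IsForwardSampling

lemma monotone_empiricalCDF (y : ℕ → ℝ) (N : ℕ) : Monotone (empiricalCDF y N) := fun s t hst =>
  mul_le_mul_of_nonneg_left (Finset.sum_le_sum fun i _ =>
    Set.indicator_le_indicator_of_subset (Set.Iic_subset_Iic.2 hst) (fun _ => zero_le_one) (y i))
    (by positivity)

theorem proposition2 {Ω : Type*} [MeasurableSpace Ω] (μ : Measure Ω) [IsProbabilityMeasure μ]
    (P₀ : Measure ℝ) [IsProbabilityMeasure P₀] (hP₀ : P₀ ≪ volume)
    (ρ : ℝ) (hρ : ρ ∈ Set.Ioo (-1 : ℝ) 1)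
    (n : ℕ) (α : ℕ → ℝ) (hα : ∀ k : ℕ, 1 ≤ k → α (n + k) ∈ Set.Icc (0 : ℝ) 1)
    (Y : ℕ → Ω → ℝ) (hY : IsForwardSampling μ P₀ ρ α n Y) :
    ∃ Pinf : Kernel Ω ℝ, IsMarkovKernel Pinf ∧
      (∀ y : ℝ, ∀ᵐ ω ∂μ,
        Tendsto (fun N => predictiveCDF P₀ ρ α n (fun j => Y j ω) N y) atTop
          (𝓝 (cdf (Pinf ω) y)) ∧
        Tendsto (fun N => empiricalCDF (fun j => Y j ω) N y) atTop
          (𝓝 (cdf (Pinf ω) y))) ∧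
      (∀ᵐ ω ∂μ, ∀ y : ℝ, ContinuousAt (cdf (Pinf ω)) y →
        Tendsto (fun N => predictiveCDF P₀ ρ α n (fun j => Y j ω) N y) atTop
          (𝓝 (cdf (Pinf ω) y)) ∧
        Tendsto (fun N => empiricalCDF (fun j => Y j ω) N y) atTop
          (𝓝 (cdf (Pinf ω) y))) := by
  have hcont : Continuous (cdf P₀) :=
    continuous_cdf_of_forall_singleton P₀ fun x => hP₀ (by simp)
  obtain ⟨κ, hκ, hlim⟩ := exists_kernel_tendsto_cdf (μ := μ) (P₀ := P₀)
    (M := fun N ω => predictiveCDF P₀ ρ α n (fun j => Y j ω) N)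
    (fun N t => (hY.measurable_predictiveCDF N t).mono
      ((sampleFiltration Y hY.measurable).le N) le_rfl)
    (fun N ω => monotone_predictiveCDF hα _ N)
    (fun N ω t => predictiveCDF_mem_Icc hα _ N t)
    (fun N t => hY.integral_predictiveCDF hρ hcont hα N t)
    (fun t => hY.ae_exists_tendsto_predictiveCDF hρ hcont hα t)
  have hboth : ∀ y : ℝ, ∀ᵐ ω ∂μ,
      Tendsto (fun N => predictiveCDF P₀ ρ α n (fun j => Y j ω) N y) atTop
        (𝓝 (cdf (κ ω) y)) ∧
      Tendsto (fun N => empiricalCDF (fun j => Y j ω) N y) atTop (𝓝 (cdf (κ ω) y)) := by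
    intro y
    filter_upwards [hlim y, hY.ae_tendsto_empiricalCDF_sub hα y] with ω h1 h2
    exact ⟨h1, by simpa using h2.add h1.cesaro⟩
  refine ⟨κ, hκ, hboth, ?_⟩
  filter_upwards [ae_all_iff.2 fun q : ℚ => hboth q] with ω hω y hy
  exact ⟨tendsto_of_tendsto_rat_of_continuousAt (monotone_predictiveCDF hα _)
      (fun q => (hω q).1) hy,
    tendsto_of_tendsto_rat_of_continuousAt (monotone_empiricalCDF _) (fun q => (hω q).2) hy⟩
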